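/- **Setting.** Let $n_c\le n$, and let $f:\mathbb R^n\to\mathbb R$ be continuously differentiable and bounded from below, with $L_f$-Lipschitz gradient. Fix constants $\eta_1,\gamma,\kappa_H\in(0,1)$, $\eta_2,\theta,\kappa_R,\kappa_f,\epsilon_f>0$, $\kappa_g\ge 0$, $L_\phi\ge0$, and a starting point $x_0\in\mathbb R^n$, $\lambda_0>0$. **The method MU$^2$STREG.** On a probability space, a run of the two-level method consists of random sequences as follows. $X_0=x_0$, $\Lambda_0=\lambda_0$. At iteration $k$ (with realizations $x_k,\lambda_k,\dots$) there are random $g_k\in\mathbb R^n$ (approximation of $\nabla f(x_k)$), a linear map $R_k:\mathbb R^n\to\mathbb R^{n_c}$ with $\|R_k\|\le\kappa_R$, and a choice between a fine and a coarse step; the coarse step may be chosen only if $\|R_kg_k\|\ge\kappa_H\|g_k\|$. * Fine step: $s_k=-g_k/(\lambda_k\|g_k\|)$, and the predicted reduction is $m_k^0-m_k^s=-g_k^Ts_k$. * Coarse step: $s_k=R_k^Ts^*_k$, where, for a random function $\phi_k:\mathbb R^{n_c}\to\mathbb R$ and $$\varphi_k(s)=\phi_k(R_kx_k+s)+(R_kg_k-\nabla\phi_k(R_kx_k))^Ts,\qquad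 m_k^R(s)=\varphi_k(s)+\tfrac{\lambda_k\|g_k\|}{2}\|s\|^2,$$ the point $s_k^*\in\mathbb R^{n_c}$ satisfies $m_k^R(s_k^*)\le m_k^R(0)$ and $\|\nabla m_k^R(s_k^*)\|\le\theta\|s_k^*\|$; the predicted reduction is $m_k^0-m_k^s=\varphi_k(0)-\varphi_k(s_k^*)$. Each $\phi_k$ (for every $k$ and every realization) is continuously differentiable and bounded from below, with $L_\phi$-Lipschitz gradient. Random estimates $f_k$ of $f(x_k)$ and $f_k^s$ of $f(x_k+s_k)$ are obtained, and $\rho_k=(f_k-f_k^s)/(m_k^0-m_k^s)$. If $\rho_k\ge\eta_1$ and $\|g_k\|\ge\eta_2/\lambda_k$, then $x_{k+1}=x_k+s_k$ and $\lambda_{k+1}=\gamma\lambda_k$; otherwise $x_{k+1}=x_k$ and $\lambda_{k+1}=\gamma^{-1}\lambda_k$. The method is run for all $k\ge0$. **Accuracy.** Let $M_k=(g_k,R_k,\text{choice of step},\phi_k,s_k^*)$. Let $\mathcal F_{k-1}$ be the $\sigma$-algebra generated by $M_j,f_j,f_j^s$, $j<k$, and let $\mathcal F_{k-1/2}$ be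 the one generated by $\mathcal F_{k-1}$ and $M_k$. Let $I_k$ be the event that the fine model $m_k(y)=f_k+g_k^T(y-x_k)$ is $(\kappa_f,\kappa_g)$-fully linear around $x_k$, i.e. that for all $y$ in some neighbourhood of $x_k$ $$\|\nabla f(y)-\nabla m_k(y)\|\le\kappa_g/\lambda_k,\qquad |f(y)-m_k(y)|\le\kappa_f/\lambda_k^2 ,$$ and let $J_k$ be the event that $|f_k-f(x_k)|\le\epsilon_f/\lambda_k^2$ and $|f_k^s-f(x_k+s_k)|\le\epsilon_f/\lambda_k^2$. The fine models are $\alpha$-probabilistically fully linear if $\mathbb P(I_k\mid\mathcal F_{k-1})\ge\alpha$ a.s. for all $k$, and the estimates are $\beta$-probabilistically accurate if $\mathbb P(J_k\mid\mathcal F_{k-1/2})\ge\beta$ a.s. for all $k$. **Theorem.** Suppose that $$\eta_2\ge\max\{L_\phi+\theta,\,24\kappa_f\},\qquad \epsilon_f\le\min\Big\{\kappa_f,\frac{\eta_1\eta_2\kappa_H^2}{32}\Big\}.$$ Then there are $\alpha,\beta\in(0,1)$, depending only on $L_f,L_\phi,\theta,\kappa_H,\kappa_R,\kappa_f,\kappa_g,\eta_1,\eta_2,\gamma$,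 such that for every run of MU$^2$STREG as above whose fine models are $\alpha$-probabilistically fully linear and whose estimates are $\beta$-probabilistically accurate, the regularization parameters satisfy $$\sum_{k=0}^\infty\frac1{\Lambda_k^2}<\infty\quad\text{almost surely.}$$ -/

import Mathlib

open MeasureTheory Filter Topology
open scoped NNReal ProbabilityTheory InnerProductSpace Gradient

namespace MU2STREG

noncomputable section

/-- Euclidean space of dimension `n`. -/
abbrev E (n : ℕ) : Type := EuclideanSpace ℝ (Fin n)

/-! ### Models -/

/-- The fine model `m`, an affine function with `m (x + s) = fk + gᵀ s`. -/
def fineModel {n : ℕ} (fk : ℝ) (g x : E n) (y : E n) : ℝ :=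
  fk + ⟪g, y - x⟫_ℝ

/-- The first-order corrected coarse model
`φc(s) = φ (R x + s) + (R g - ∇ φ (R x))ᵀ s`. -/
def coarseModel {n nc : ℕ} (φ : E nc → ℝ) (R : E n →L[ℝ] E nc) (g x : E n) (s : E nc) : ℝ :=
  φ (R x + s) + ⟪R g - ∇ φ (R x), s⟫_ℝ

/-- The regularized coarse model `φc(s) + (lam ‖g‖ / 2) ‖s‖ ^ 2`. -/
def regModel {n nc : ℕ} (φ : E nc → ℝ) (R : E n →L[ℝ] E nc) (g x : E n) (lam : ℝ)
    (s : E nc) : ℝ :=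
  coarseModel φ R g x s + lam * ‖g‖ / 2 * ‖s‖ ^ 2

/-- `m` is a `(κf, κg)`-fully linear model of `f` around `x` for the regularization
parameter `lam`: the two error bounds hold on some neighbourhood of `x`. -/
def IsFullyLinear {n : ℕ} (f m : E n → ℝ) (κf κg lam : ℝ) (x : E n) : Prop :=
  ∀ᶠ y in 𝓝 x, ‖∇ f y - ∇ m y‖ ≤ κg / lam ∧ |f y - m y| ≤ κf / lam ^ 2

/-- `a` and `b` are `εf`-accurate estimates of `f x` and `f (x + s)`. -/
def IsAccurate {n : ℕ} (f : E n → ℝ) (εf lam : ℝ) (x s : E n) (a b : ℝ) : Prop :=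
  |a - f x| ≤ εf / lam ^ 2 ∧ |b - f (x + s)| ≤ εf / lam ^ 2

/-- The constants of the method. -/
structure Constants where
  /-- acceptance threshold for the ratio of achieved to predicted reduction -/
  η1 : ℝ
  /-- acceptance threshold for `lam * ‖g‖` -/
  η2 : ℝ
  /-- update factor of the regularization parameter -/
  γ : ℝ
  /-- stopping tolerance of the coarse minimization -/
  θ : ℝ
  /-- threshold in the condition under which a coarse step is allowed -/
  κH : ℝ
  /-- bound on the restriction operators -/
  κR : ℝ

/-! ### The random quantities of a run -/

/-- The random quantities appearing in a run of the two-level method.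
The fine model at iteration `k` is `fineModel (F k ω) (G k ω) (X k ω)`. -/
structure Run (Ω : Type*) (n nc : ℕ) where
  /-- iterates -/
  X : ℕ → Ω → E n
  /-- regularization parameters -/
  Λ : ℕ → Ω → ℝ
  /-- approximations of the gradient of the objective at the iterates -/
  G : ℕ → Ω → E n
  /-- restriction operators; the prolongation operators are their adjoints -/
  R : ℕ → Ω → (E n →L[ℝ] E nc)
  /-- whether the coarse step is chosen -/
  coarse : ℕ → Ω → Bool
  /-- coarse approximations of the objective -/
  φ : ℕ → Ω → E nc → ℝ
  /-- approximate minimizers of the regularized coarse models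
  (they play a role only when the coarse step is chosen) -/
  sStar : ℕ → Ω → E nc
  /-- estimates of the objective at the iterates -/
  F : ℕ → Ω → ℝ
  /-- estimates of the objective at the trial points -/
  Fs : ℕ → Ω → ℝ

namespace Run

variable {Ω : Type*} {n nc : ℕ} (p : Run Ω n nc)

/-- The step: `Rᵀ s*` for a coarse step, `- g / (lam ‖g‖)` for a fine step. -/
def S (k : ℕ) (ω : Ω) : E n :=
  if p.coarse k ω then ContinuousLinearMap.adjoint (p.R k ω) (p.sStar k ω)
  else -((p.Λ k ω * ‖p.G k ω‖)⁻¹ • p.G k ω)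

/-- The coarse model at iteration `k`. -/
def phiModel (k : ℕ) (ω : Ω) : E nc → ℝ :=
  coarseModel (p.φ k ω) (p.R k ω) (p.G k ω) (p.X k ω)

/-- The regularized coarse model at iteration `k`. -/
def mR (k : ℕ) (ω : Ω) : E nc → ℝ :=
  regModel (p.φ k ω) (p.R k ω) (p.G k ω) (p.X k ω) (p.Λ k ω)

/-- The fine model at iteration `k`. -/
def m (k : ℕ) (ω : Ω) : E n → ℝ :=
  fineModel (p.F k ω) (p.G k ω) (p.X k ω)

/-- The value `m_k^0` of the model in use at the zero step. -/
def m0 (k : ℕ) (ω : Ω) : ℝ :=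
  if p.coarse k ω then p.phiModel k ω 0 else p.m k ω (p.X k ω)

/-- The value `m_k^s` of the model in use at the computed step. -/
def ms (k : ℕ) (ω : Ω) : ℝ :=
  if p.coarse k ω then p.phiModel k ω (p.sStar k ω) else p.m k ω (p.X k ω + p.S k ω)

/-- Ratio of the achieved to the predicted reduction. -/
def ρ (k : ℕ) (ω : Ω) : ℝ :=
  (p.F k ω - p.Fs k ω) / (p.m0 k ω - p.ms k ω)

/-- Iteration `k` is successful. -/
def Successful (c : Constants) (k : ℕ) (ω : Ω) : Prop :=
  c.η1 ≤ p.ρ k ω ∧ c.η2 / p.Λ k ω ≤ ‖p.G k ω‖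

/-- The random data `M k` determining the models and the step of iteration `k`. -/
def M (k : ℕ) (ω : Ω) : E n × (E n →L[ℝ] E nc) × Bool × (E nc → ℝ) × E nc :=
  (p.G k ω, p.R k ω, p.coarse k ω, p.φ k ω, p.sStar k ω)

/-- The two function estimates of iteration `k`. -/
def est (k : ℕ) (ω : Ω) : ℝ × ℝ := (p.F k ω, p.Fs k ω)

/-- The σ-algebra of the past of iteration `k`, generated by the models and the estimates of the
iterations `0, …, k - 1` (the trivial σ-algebra for `k = 0`). -/
@[reducible] def past (k : ℕ) : MeasurableSpace Ω :=
  ⨆ j ∈ Finset.range k,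
    (MeasurableSpace.comap (p.M j) inferInstance ⊔ MeasurableSpace.comap (p.est j) inferInstance)

/-- The σ-algebra generated by the models of the iterations `0, …, k` and the estimates of the
iterations `0, …, k - 1`. -/
@[reducible] def pastHalf (k : ℕ) : MeasurableSpace Ω :=
  p.past k ⊔ MeasurableSpace.comap (p.M k) inferInstance

/-- `p` is a run, on the measurable space `Ω`, of the two-level stochastic regularized gradient
method started at `x0` with regularization parameter `lam0`. -/
structure IsMU2STREG [MeasurableSpace Ω] (c : Constants) (x0 : E n) (lam0 : ℝ) : Prop where
  measurable_M : ∀ k, Measurable (p.M k)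
  measurable_est : ∀ k, Measurable (p.est k)
  X_zero : ∀ ω, p.X 0 ω = x0
  Λ_zero : ∀ ω, p.Λ 0 ω = lam0
  /-- the restriction operators are bounded by `κR` -/
  norm_R_le : ∀ k ω, ‖p.R k ω‖ ≤ c.κR
  /-- coarse steps are only taken if `‖R g‖ ≥ κH ‖g‖` -/
  coarse_allowed : ∀ k ω, p.coarse k ω = true → c.κH * ‖p.G k ω‖ ≤ ‖p.R k ω (p.G k ω)‖
  /-- decrease of the regularized coarse model -/
  coarse_decrease : ∀ k ω, p.coarse k ω = true → p.mR k ω (p.sStar k ω) ≤ p.mR k ω 0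
  /-- approximate stationarity for the regularized coarse model -/
  coarse_stationary : ∀ k ω, p.coarse k ω = true →
    ‖∇ (p.mR k ω) (p.sStar k ω)‖ ≤ c.θ * ‖p.sStar k ω‖
  /-- update after a successful iteration -/
  success : ∀ k ω, p.Successful c k ω →
    p.X (k + 1) ω = p.X k ω + p.S k ω ∧ p.Λ (k + 1) ω = c.γ * p.Λ k ω
  /-- update after an unsuccessful iteration -/
  failure : ∀ k ω, ¬ p.Successful c k ω →
    p.X (k + 1) ω = p.X k ω ∧ p.Λ (k + 1) ω = c.γ⁻¹ * p.Λ k ω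

/-- The event `I k` that the fine model of iteration `k` is fully linear around the iterate. -/
def I (f : E n → ℝ) (κf κg : ℝ) (k : ℕ) : Set Ω :=
  {ω | IsFullyLinear f (p.m k ω) κf κg (p.Λ k ω) (p.X k ω)}

/-- The event `J k` that the estimates of iteration `k` are accurate. -/
def J (f : E n → ℝ) (εf : ℝ) (k : ℕ) : Set Ω :=
  {ω | IsAccurate f εf (p.Λ k ω) (p.X k ω) (p.S k ω) (p.F k ω) (p.Fs k ω)}

/-- The fine models are `α`-probabilistically `(κf, κg)`-fully linear. -/
def ProbFullyLinear [MeasurableSpace Ω] (μ : Measure Ω) (f : E n → ℝ) (κf κg α : ℝ) : Prop :=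
  ∀ k, ∀ᵐ ω ∂μ, α ≤ (μ⟦p.I f κf κg k | p.past k⟧) ω

/-- The estimates are `β`-probabilistically `εf`-accurate. -/
def ProbAccurate [MeasurableSpace Ω] (μ : Measure Ω) (f : E n → ℝ) (εf β : ℝ) : Prop :=
  ∀ k, ∀ᵐ ω ∂μ, β ≤ (μ⟦p.J f εf k | p.pastHalf k⟧) ω

end Run

/-- `f` is continuously differentiable, bounded from below, and its gradient is `L`-Lipschitz. -/
def IsSmoothBelow {n : ℕ} (f : E n → ℝ) (L : ℝ≥0) : Prop :=
  ContDiff ℝ 1 f ∧ BddBelow (Set.range f) ∧ LipschitzWith L (∇ f)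

end

end MU2STREG

/-!
The proof is a drift argument for the Lyapunov function `weight * f x + 1 / lam ^ 2`
(`Run.lyap`).

Once `lam * ‖g‖ ≥ η2`, fine and coarse steps satisfy the same three estimates
(`Run.StepBounds`): the predicted reduction is at least `κH ^ 2 / 8 * ‖g‖ / lam`, it agrees with
`-gᵀ s` up to `O (1 / lam ^ 2)`, and `‖s‖ = O (1 / lam)`. For coarse steps, the condition
`η2 ≥ Lφ + θ` enters through the approximate stationarity, which bounds `‖s*‖` from below, and
through the decrease of the regularized model, which bounds it from above.

Consequently, a successful iteration with accurate estimates decreases `f` by a multiple of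
`‖g‖ / lam ≥ η2 / lam ^ 2`, and an iteration with accurate model and estimates is successful as soon
as `lam * ‖∇ f x‖` exceeds a constant `ζ`. An unsuccessful iteration multiplies `1 / lam ^ 2` by
`γ ^ 2 < 1`, and inaccurate estimates increase `f` by at most `O (‖∇ f x‖ / lam + 1 / lam ^ 2)`. For
a large weight this gives the pointwise bound `Run.IsMU2STREG.lyap_drift`: with `u = 1 / lam ^ 2` and
`w` equal to `‖∇ f x‖ / lam` where `lam * ‖∇ f x‖ ≥ ζ` and to `0` elsewhere, the Lyapunov function
changes by at most `-(1 - γ ^ 2) * u - gain * w`, plus `loss * (w + u)` for each of the two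
accuracy events that fails.

Since `w + u` is measurable with respect to the past and each accuracy event has conditional
probability at least `1 - δ`, the expected loss is at most `2 * δ * loss * E[w + u]`
(`integral_mul_indicator_compl_le`). This union bound needs no relation between the two
events, so it does not matter that the fully linear event also involves the function estimates.
For small `δ` the expected Lyapunov function decreases by at least `(1 - γ ^ 2) / 2 * E[u]` in
each iteration. It is bounded below, so `∑ E[1 / lam ^ 2]` converges, and so does
`∑ 1 / lam ^ 2` almost surely, by monotone convergence.
-/

namespace MU2STREG

/-! ### Gradients and the quadratic Taylor bound -/

theorem IsSmoothBelow.hasGradientAt {n : ℕ} {f : E n → ℝ} {L : ℝ≥0} (hf : IsSmoothBelow f L)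
    (x : E n) : HasGradientAt f (∇ f x) x :=
  (hf.1.differentiable one_ne_zero x).hasGradientAt

theorem IsSmoothBelow.norm_gradient_sub_le {n : ℕ} {f : E n → ℝ} {L : ℝ≥0}
    (hf : IsSmoothBelow f L) (x s : E n) : ‖∇ f (x + s) - ∇ f x‖ ≤ L * ‖s‖ := by
  simpa using hf.2.2.norm_sub_le (x + s) x

/-- Taylor's bound for a function with `L`-Lipschitz gradient. -/
theorem IsSmoothBelow.abs_sub_sub_inner_le {n : ℕ} {f : E n → ℝ} {L : ℝ≥0}
    (hf : IsSmoothBelow f L) (x s : E n) :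
    |f (x + s) - f x - ⟪∇ f x, s⟫_ℝ| ≤ L / 2 * ‖s‖ ^ 2 := by
  have hderiv : ∀ t : ℝ, HasDerivAt (fun t : ℝ => f (x + t • s) - f x - t * ⟪∇ f x, s⟫_ℝ)
      (⟪∇ f (x + t • s) - ∇ f x, s⟫_ℝ) t := by
    intro t
    have h1 : HasDerivAt (fun t : ℝ => x + t • s) s t := by
      simpa using ((hasDerivAt_id t).smul_const s).const_add x
    have h2 := (hf.hasGradientAt (x + t • s)).hasFDerivAt.comp_hasDerivAt t h1
    have h3 := (h2.sub_const (f x)).sub ((hasDerivAt_id t).mul_const ⟪∇ f x, s⟫_ℝ)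
    exact h3.congr_deriv (by simp [inner_sub_left])
  have hB : ∀ t : ℝ, HasDerivAt (fun t : ℝ => L / 2 * ‖s‖ ^ 2 * t ^ 2) (L * t * ‖s‖ ^ 2) t := by
    intro t
    exact (((hasDerivAt_id t).pow 2).const_mul ((L : ℝ) / 2 * ‖s‖ ^ 2)).congr_deriv
      (by simp; ring)
  have := image_norm_le_of_norm_deriv_right_le_deriv_boundary (a := 0) (b := 1)
    (f := fun t : ℝ => f (x + t • s) - f x - t * ⟪∇ f x, s⟫_ℝ)
    (f' := fun t => ⟪∇ f (x + t • s) - ∇ f x, s⟫_ℝ)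
    (B := fun t => L / 2 * ‖s‖ ^ 2 * t ^ 2) (B' := fun t => L * t * ‖s‖ ^ 2)
    (fun t _ => (hderiv t).continuousAt.continuousWithinAt)
    (fun t _ => (hderiv t).hasDerivWithinAt) (by simp) hB ?_
    (x := 1) (by simp)
  · simpa using this
  · intro t ht
    calc ‖⟪∇ f (x + t • s) - ∇ f x, s⟫_ℝ‖ ≤ ‖∇ f (x + t • s) - ∇ f x‖ * ‖s‖ := norm_inner_le_norm _ _
      _ ≤ (L * ‖t • s‖) * ‖s‖ := by gcongr; exact hf.norm_gradient_sub_le x _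
      _ = L * t * ‖s‖ ^ 2 := by rw [norm_smul, Real.norm_of_nonneg ht.1]; ring

theorem gradient_fineModel {n : ℕ} (fk : ℝ) (g x y : E n) : ∇ (fineModel fk g x) y = g := by
  apply HasGradientAt.gradient
  rw [hasGradientAt_iff_hasFDerivAt]
  have h := (((InnerProductSpace.toDual ℝ (E n)) g).hasFDerivAt (x := y - x)).comp y
    ((hasFDerivAt_id y).sub_const x)
  exact (h.const_add fk)

theorem gradient_regModel {n nc : ℕ} {φ : E nc → ℝ} {L : ℝ≥0} (hφ : IsSmoothBelow φ L)
    (R : E n →L[ℝ] E nc) (g x : E n) (lam : ℝ) (s : E nc) :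
    ∇ (regModel φ R g x lam) s =
      (∇ φ (R x + s) - ∇ φ (R x)) + R g + (lam * ‖g‖) • s := by
  apply HasGradientAt.gradient
  rw [hasGradientAt_iff_hasFDerivAt]
  have h1 := (hφ.hasGradientAt (R x + s)).hasFDerivAt.comp s
    ((hasFDerivAt_id s).const_add (R x))
  have h2 := ((InnerProductSpace.toDual ℝ (E nc)) (R g - ∇ φ (R x))).hasFDerivAt (x := s)
  have h3 := ((hasStrictFDerivAt_norm_sq s).hasFDerivAt).const_mul (lam * ‖g‖ / 2)
  refine ((h1.add h2).add h3).congr_fderiv ?_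
  ext v
  simp
  ring

/-! ### The coarse step -/

section CoarseStep

variable {n nc : ℕ} {φ : E nc → ℝ} {L : ℝ≥0} {R : E n →L[ℝ] E nc} {g x : E n} {lam : ℝ} {s : E nc}

/-- The regularization term is a lower bound of the predicted reduction. -/
theorem coarseModel_reduction_ge (h : regModel φ R g x lam s ≤ regModel φ R g x lam 0) :
    lam * ‖g‖ / 2 * ‖s‖ ^ 2 ≤ coarseModel φ R g x 0 - coarseModel φ R g x s := by
  simp only [regModel, norm_zero] at h
  linarith

/-- The first-order correction makes the coarse model agree with the fine model to first order
along prolonged steps. -/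
theorem abs_coarseModel_sub_le (hφ : IsSmoothBelow φ L) :
    |coarseModel φ R g x s - coarseModel φ R g x 0
      - ⟪g, ContinuousLinearMap.adjoint R s⟫_ℝ| ≤ L / 2 * ‖s‖ ^ 2 := by
  have := hφ.abs_sub_sub_inner_le (R x) s
  rw [ContinuousLinearMap.adjoint_inner_right]
  simp only [coarseModel, inner_sub_left, inner_zero_right, add_zero]
  convert this using 2
  ring

/-- Approximate stationarity forces `‖R g‖ ≤ (θ + L + lam ‖g‖) ‖s‖`, so the step cannot be short. -/
theorem norm_coarse_step_ge {κH θ : ℝ} (hφ : IsSmoothBelow φ L) (hlam : 0 < lam) (hg : 0 < ‖g‖)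
    (hLθ : L + θ ≤ lam * ‖g‖) (hR : κH * ‖g‖ ≤ ‖R g‖)
    (hs : ‖∇ (regModel φ R g x lam) s‖ ≤ θ * ‖s‖) : κH / (2 * lam) ≤ ‖s‖ := by
  rw [gradient_regModel hφ] at hs
  have h1 := hφ.norm_gradient_sub_le (R x) s
  set a := ∇ φ (R x + s) - ∇ φ (R x)
  have h2 : ‖R g‖ ≤ ‖a + R g + (lam * ‖g‖) • s‖ + ‖a‖ + ‖(lam * ‖g‖) • s‖ := by
    have : R g = (a + R g + (lam * ‖g‖) • s) - a - (lam * ‖g‖) • s := by abel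
    conv_lhs => rw [this]
    exact (norm_sub_le _ _).trans (by gcongr; exact norm_sub_le _ _)
  rw [norm_smul, Real.norm_of_nonneg (by positivity)] at h2
  have h3 : κH * ‖g‖ ≤ 2 * lam * ‖s‖ * ‖g‖ := by
    nlinarith [norm_nonneg s]
  have h4 := le_of_mul_le_mul_right h3 hg
  rw [div_le_iff₀ (by positivity)]
  linarith

/-- The decrease of the regularized model, whose curvature is at least `lam ‖g‖ - L > 0`, bounds the
step. -/
theorem norm_coarse_step_le {κR θ η : ℝ} (hφ : IsSmoothBelow φ L) (hlam : 0 < lam)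
    (hθ : 0 < θ) (hη : 0 < η) (hLη : L + θ ≤ η) (hg : η ≤ lam * ‖g‖) (hR : ‖R‖ ≤ κR)
    (h : regModel φ R g x lam s ≤ regModel φ R g x lam 0) :
    ‖s‖ ≤ 2 * κR * η / θ / lam := by
  have h1 := coarseModel_reduction_ge h
  have h2 := (abs_le.1 (abs_coarseModel_sub_le (R := R) (g := g) (x := x) (s := s) hφ)).1
  rw [ContinuousLinearMap.adjoint_inner_right] at h2
  have h3 : -⟪R g, s⟫_ℝ ≤ κR * ‖g‖ * ‖s‖ :=
    calc -⟪R g, s⟫_ℝ ≤ ‖R g‖ * ‖s‖ := (neg_le_abs _).trans (abs_real_inner_le_norm _ _)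
      _ ≤ κR * ‖g‖ * ‖s‖ := by gcongr; exact R.le_of_opNorm_le hR g
  have hg0 : 0 < ‖g‖ := by
    by_contra hg0
    have : ‖g‖ = 0 := le_antisymm (not_lt.1 hg0) (norm_nonneg _)
    rw [this] at hg
    linarith
  have hκR : 0 ≤ κR := (norm_nonneg R).trans hR
  rcases (norm_nonneg s).eq_or_lt with hs | hs
  · rw [← hs]
    positivity
  have h4 : (lam * ‖g‖ - L) * ‖s‖ ≤ 2 * κR * ‖g‖ := by
    refine le_of_mul_le_mul_right ?_ hs
    nlinarith
  -- Since `L ≤ η - θ`, the curvature `lam ‖g‖ - L` is at least the fraction `θ / η` of `lam ‖g‖`.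
  have h5 : θ * (lam * ‖g‖) ≤ η * (lam * ‖g‖ - L) := by
    nlinarith [mul_le_mul_of_nonneg_left hLη (by positivity : 0 ≤ lam * ‖g‖),
      mul_le_mul_of_nonneg_left hg L.2]
  rw [div_div, le_div_iff₀ (by positivity)]
  refine le_of_mul_le_mul_right ?_ hg0
  nlinarith [mul_le_mul_of_nonneg_right h5 hs.le, mul_le_mul_of_nonneg_left h4 hη.le]

end CoarseStep

noncomputable section

/-! ### The constants of the analysis -/

/-- A constant `b` such that accepted steps have norm at most `b / lam`. The summand `1` accounts
for fine steps, the other one for coarse steps. -/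
def Constants.step (c : Constants) : ℝ := 1 + c.κR * (2 * c.κR * c.η2 / c.θ)

/-- A constant `a` such that the predicted reduction is at most `-gᵀ s + a / lam ^ 2`. -/
def Constants.curv (c : Constants) (Lφ : ℝ≥0) : ℝ := Lφ / 2 * (2 * c.κR * c.η2 / c.θ) ^ 2

/-- A constant `e` such that, when the model and the estimates are accurate, the estimated reduction
is at least the predicted one minus `e / lam ^ 2`. -/
def Constants.err (c : Constants) (Lf Lφ : ℝ≥0) (κf κg : ℝ) : ℝ :=
  c.curv Lφ + κg * c.step + Lf / 2 * c.step ^ 2 + 2 * κf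

/-- A constant `ζ` such that an iteration with accurate model and estimates is successful
as soon as `‖∇ f x‖ ≥ ζ / lam`. -/
def Constants.threshold (c : Constants) (Lf Lφ : ℝ≥0) (κf κg : ℝ) : ℝ :=
  2 * κg + 2 * c.η2 + 16 * c.err Lf Lφ κf κg / ((1 - c.η1) * c.κH ^ 2)

/-- A constant `r` such that a successful iteration with accurate estimates decreases the objective
by at least `r ‖g‖ / lam`. -/
def Constants.rate (c : Constants) : ℝ := c.η1 * c.κH ^ 2 / 16

/-- The weight of the objective in the Lyapunov function `weight * f x + 1 / lam ^ 2`. It is so large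
that the decrease of the objective outweighs the growth of `1 / lam ^ 2` by the factor `γ⁻¹ ^ 2`
in a successful iteration with accurate estimates. -/
def Constants.weight (c : Constants) : ℝ := 2 * c.γ⁻¹ ^ 2 / (c.rate * c.η2)

/-- The coefficient of the gradient term in the guaranteed decrease of the Lyapunov function. -/
def Constants.gain (c : Constants) : ℝ := c.weight * c.rate / 4

/-- The coefficient in the worst possible increase of the Lyapunov function when the model or the
estimates are inaccurate. -/
def Constants.loss (c : Constants) (Lf Lφ : ℝ≥0) (κf κg : ℝ) : ℝ :=
  c.weight * (c.step + c.step * c.threshold Lf Lφ κf κg + Lf / 2 * c.step ^ 2) + c.gain + c.γ⁻¹ ^ 2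

/-- The admissible ranges of the constants, as in the setting of the method. -/
structure Constants.Valid (c : Constants) (Lφ : ℝ≥0) (κf κg : ℝ) : Prop where
  η1_pos : 0 < c.η1
  η1_lt : c.η1 < 1
  γ_pos : 0 < c.γ
  γ_lt : c.γ < 1
  θ_pos : 0 < c.θ
  κH_pos : 0 < c.κH
  κH_lt : c.κH < 1
  κR_pos : 0 < c.κR
  κf_pos : 0 < κf
  κg_nonneg : 0 ≤ κg
  η2_pos : 0 < c.η2
  le_η2 : Lφ + c.θ ≤ c.η2

namespace Constants.Valid

variable {c : Constants} {Lf Lφ : ℝ≥0} {κf κg : ℝ}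

theorem step_pos (h : c.Valid Lφ κf κg) : 0 < c.step := by
  have := h.κR_pos; have := h.η2_pos; have := h.θ_pos
  unfold Constants.step; positivity

theorem err_pos (h : c.Valid Lφ κf κg) : 0 < c.err Lf Lφ κf κg := by
  have := h.step_pos; have := h.κf_pos; have := h.κg_nonneg
  unfold Constants.err Constants.curv; positivity

theorem threshold_pos (h : c.Valid Lφ κf κg) : 0 < c.threshold Lf Lφ κf κg := by
  have := h.err_pos (Lf := Lf); have := h.κg_nonneg; have := h.η2_pos
  have := sub_pos.2 h.η1_lt; have := h.κH_pos
  unfold Constants.threshold; positivity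

theorem rate_pos (h : c.Valid Lφ κf κg) : 0 < c.rate := by
  have := h.η1_pos; have := h.κH_pos
  unfold Constants.rate; positivity

theorem weight_pos (h : c.Valid Lφ κf κg) : 0 < c.weight := by
  have := h.rate_pos; have := h.γ_pos; have := h.η2_pos
  unfold Constants.weight; positivity

theorem gain_pos (h : c.Valid Lφ κf κg) : 0 < c.gain := by
  have := h.rate_pos; have := h.weight_pos
  unfold Constants.gain; positivity

theorem gain_lt_loss (h : c.Valid Lφ κf κg) : c.gain < c.loss Lf Lφ κf κg := by
  have := h.step_pos; have := h.weight_pos; have := h.threshold_pos (Lf := Lf); have := h.γ_pos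
  have : 0 < c.weight * (c.step + c.step * c.threshold Lf Lφ κf κg + Lf / 2 * c.step ^ 2)
    + c.γ⁻¹ ^ 2 := by positivity
  unfold Constants.loss
  linarith

end Constants.Valid

/-! ### A single iteration -/

namespace Run

variable {Ω : Type*} {n nc : ℕ} {p : Run Ω n nc} {c : Constants} {Lf Lφ : ℝ≥0}
  {κf κg εf : ℝ} {x0 : E n} {lam0 : ℝ} {f : E n → ℝ} {k : ℕ} {ω : Ω}

/-- What the analysis needs to know about a trial step, fine or coarse. -/
structure StepBounds (p : Run Ω n nc) (c : Constants) (Lφ : ℝ≥0) (k : ℕ) (ω : Ω) : Prop where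
  le_pred : c.κH ^ 2 / 8 * (‖p.G k ω‖ / p.Λ k ω) ≤ p.m0 k ω - p.ms k ω
  pred_le : p.m0 k ω - p.ms k ω ≤ -⟪p.G k ω, p.S k ω⟫_ℝ + c.curv Lφ / p.Λ k ω ^ 2
  norm_le : ‖p.S k ω‖ ≤ c.step / p.Λ k ω

/-- The first-order increase of the objective along a step of norm at most `b / lam`. -/
theorem StepBounds.objective_le (h : p.StepBounds c Lφ k ω) (hf : IsSmoothBelow f Lf) :
    f (p.X k ω + p.S k ω) ≤ f (p.X k ω) + c.step * (‖∇ f (p.X k ω)‖ / p.Λ k ω)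
      + Lf / 2 * c.step ^ 2 * (1 / p.Λ k ω ^ 2) := by
  have h1 := (abs_le.1 (hf.abs_sub_sub_inner_le (p.X k ω) (p.S k ω))).2
  have h2 : ⟪∇ f (p.X k ω), p.S k ω⟫_ℝ ≤ c.step * (‖∇ f (p.X k ω)‖ / p.Λ k ω) :=
    calc ⟪∇ f (p.X k ω), p.S k ω⟫_ℝ ≤ ‖∇ f (p.X k ω)‖ * ‖p.S k ω‖ := real_inner_le_norm _ _
      _ ≤ ‖∇ f (p.X k ω)‖ * (c.step / p.Λ k ω) := by gcongr; exact h.norm_le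
      _ = _ := by ring
  have h3 : (Lf : ℝ) / 2 * ‖p.S k ω‖ ^ 2 ≤ Lf / 2 * c.step ^ 2 * (1 / p.Λ k ω ^ 2) :=
    calc (Lf : ℝ) / 2 * ‖p.S k ω‖ ^ 2 ≤ Lf / 2 * (c.step / p.Λ k ω) ^ 2 := by gcongr; exact h.norm_le
      _ = _ := by rw [div_pow]; ring
  linarith

/-- A successful iteration with accurate estimates decreases the objective. -/
theorem StepBounds.objective_decrease (h : p.StepBounds c Lφ k ω) (hc : c.Valid Lφ κf κg)
    (hεf : εf ≤ c.η1 * c.η2 * c.κH ^ 2 / 32)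
    (hΛ : 0 < p.Λ k ω) (hs : p.Successful c k ω) (hJ : ω ∈ p.J f εf k) :
    f (p.X k ω + p.S k ω) ≤ f (p.X k ω) - c.rate * (‖p.G k ω‖ / p.Λ k ω) := by
  have hη1 := hc.η1_pos
  have hκH := hc.κH_pos
  have hG0 : 0 < ‖p.G k ω‖ := lt_of_lt_of_le (div_pos hc.η2_pos hΛ) hs.2
  have hpos : 0 < p.m0 k ω - p.ms k ω := lt_of_lt_of_le (by positivity) h.le_pred
  have h1 : c.η1 * (p.m0 k ω - p.ms k ω) ≤ p.F k ω - p.Fs k ω := (le_div_iff₀ hpos).1 hs.1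
  have h2 := mul_le_mul_of_nonneg_left h.le_pred hη1.le
  have h3 : εf / p.Λ k ω ^ 2 ≤ c.η1 * c.κH ^ 2 / 32 * (‖p.G k ω‖ / p.Λ k ω) :=
    calc εf / p.Λ k ω ^ 2 ≤ c.η1 * c.η2 * c.κH ^ 2 / 32 / p.Λ k ω ^ 2 := by gcongr
      _ = c.η1 * c.κH ^ 2 / 32 * (c.η2 / p.Λ k ω / p.Λ k ω) := by ring
      _ ≤ _ := by gcongr; exact hs.2
  have h4 := (abs_le.1 hJ.1).2
  have h5 := (abs_le.1 hJ.2).1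
  unfold Constants.rate
  linarith

/-- The Lyapunov function `weight * f x + 1 / lam ^ 2`. -/
def lyap (p : Run Ω n nc) (c : Constants) (f : E n → ℝ) (k : ℕ) (ω : Ω) : ℝ :=
  c.weight * f (p.X k ω) + 1 / p.Λ k ω ^ 2

open Classical in
/-- The quantity `‖∇ f x‖ / lam` where `‖∇ f x‖ ≥ ζ / lam`, and `0` elsewhere. -/
def bigGrad (p : Run Ω n nc) (f : E n → ℝ) (ζ : ℝ) (k : ℕ) (ω : Ω) : ℝ :=
  if ζ / p.Λ k ω ≤ ‖∇ f (p.X k ω)‖ then ‖∇ f (p.X k ω)‖ / p.Λ k ω else 0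

theorem bigGrad_nonneg (hΛ : 0 < p.Λ k ω) (ζ : ℝ) : 0 ≤ p.bigGrad f ζ k ω := by
  unfold bigGrad
  split_ifs <;> positivity

theorem le_bigGrad_add (hΛ : 0 < p.Λ k ω) {ζ : ℝ} (hζ : 0 ≤ ζ) :
    ‖∇ f (p.X k ω)‖ / p.Λ k ω ≤ p.bigGrad f ζ k ω + ζ * (1 / p.Λ k ω ^ 2) := by
  unfold bigGrad
  split_ifs with h
  · have : 0 ≤ ζ * (1 / p.Λ k ω ^ 2) := by positivity
    linarith
  · calc ‖∇ f (p.X k ω)‖ / p.Λ k ω ≤ ζ / p.Λ k ω / p.Λ k ω := by gcongr; exact (not_le.1 h).le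
      _ = _ := by field_simp; simp

variable [MeasurableSpace Ω]

theorem IsMU2STREG.Λ_pos (hp : p.IsMU2STREG c x0 lam0) (hγ : 0 < c.γ) (hlam0 : 0 < lam0)
    (k : ℕ) (ω : Ω) : 0 < p.Λ k ω := by
  induction k with
  | zero => rwa [hp.Λ_zero]
  | succ k ih =>
    by_cases hs : p.Successful c k ω
    · rw [(hp.success k ω hs).2]; positivity
    · rw [(hp.failure k ω hs).2]; positivity

theorem IsMU2STREG.stepBounds (hp : p.IsMU2STREG c x0 lam0) (hc : c.Valid Lφ κf κg)
    (hφ : IsSmoothBelow (p.φ k ω) Lφ) (hΛ : 0 < p.Λ k ω)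
    (hG : c.η2 / p.Λ k ω ≤ ‖p.G k ω‖) : p.StepBounds c Lφ k ω := by
  have hη2 := hc.η2_pos
  have hθ := hc.θ_pos
  have hκR := hc.κR_pos
  have hκH := hc.κH_pos
  have hG0 : 0 < ‖p.G k ω‖ := lt_of_lt_of_le (by positivity) hG
  have hG' : c.η2 ≤ p.Λ k ω * ‖p.G k ω‖ := by
    rw [div_le_iff₀ hΛ] at hG; linarith
  cases hco : p.coarse k ω with
  | false =>
    have hS : p.S k ω = -((p.Λ k ω * ‖p.G k ω‖)⁻¹ • p.G k ω) := by simp [Run.S, hco]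
    have hpred : p.m0 k ω - p.ms k ω = -⟪p.G k ω, p.S k ω⟫_ℝ := by
      simp [Run.m0, Run.ms, hco, Run.m, fineModel]
    have hval : -⟪p.G k ω, p.S k ω⟫_ℝ = ‖p.G k ω‖ / p.Λ k ω := by
      rw [hS, inner_neg_right, real_inner_smul_right, real_inner_self_eq_norm_sq]
      field_simp
    have hnorm : ‖p.S k ω‖ = 1 / p.Λ k ω := by
      rw [hS, norm_neg, norm_smul, Real.norm_of_nonneg (by positivity)]
      field_simp
    refine ⟨?_, ?_, ?_⟩
    · rw [hpred, hval]
      have : 0 ≤ ‖p.G k ω‖ / p.Λ k ω := by positivity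
      have hκ : c.κH ^ 2 ≤ 1 := pow_le_one₀ hκH.le hc.κH_lt.le
      nlinarith
    · rw [hpred]
      have : 0 ≤ c.curv Lφ / p.Λ k ω ^ 2 := by unfold Constants.curv; positivity
      linarith
    · rw [hnorm]
      gcongr
      unfold Constants.step
      have : 0 ≤ c.κR * (2 * c.κR * c.η2 / c.θ) := by positivity
      linarith
  | true =>
    have hS : p.S k ω = ContinuousLinearMap.adjoint (p.R k ω) (p.sStar k ω) := by
      simp [Run.S, hco]
    have hpred : p.m0 k ω - p.ms k ω = p.phiModel k ω 0 - p.phiModel k ω (p.sStar k ω) := by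
      simp [Run.m0, Run.ms, hco]
    have hdec := hp.coarse_decrease k ω hco
    have hge := norm_coarse_step_ge hφ hΛ hG0 (hc.le_η2.trans hG') (hp.coarse_allowed k ω hco)
      (hp.coarse_stationary k ω hco)
    have hle := norm_coarse_step_le hφ hΛ hθ hη2 hc.le_η2 hG' (hp.norm_R_le k ω) hdec
    have hred := coarseModel_reduction_ge hdec
    have htay := (abs_le.1 (abs_coarseModel_sub_le (R := p.R k ω) (g := p.G k ω) (x := p.X k ω)
      (s := p.sStar k ω) hφ)).1
    refine ⟨?_, ?_, ?_⟩
    · rw [hpred]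
      refine le_trans ?_ hred
      calc c.κH ^ 2 / 8 * (‖p.G k ω‖ / p.Λ k ω)
          = p.Λ k ω * ‖p.G k ω‖ / 2 * (c.κH / (2 * p.Λ k ω)) ^ 2 := by field_simp; norm_num
        _ ≤ p.Λ k ω * ‖p.G k ω‖ / 2 * ‖p.sStar k ω‖ ^ 2 := by gcongr
    · rw [hpred, hS]
      have : Lφ / 2 * ‖p.sStar k ω‖ ^ 2 ≤ c.curv Lφ / p.Λ k ω ^ 2 := by
        rw [Constants.curv, mul_div_assoc, ← div_pow]
        gcongr
      simp only [Run.phiModel]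
      linarith
    · rw [hS]
      calc ‖ContinuousLinearMap.adjoint (p.R k ω) (p.sStar k ω)‖
          ≤ c.κR * ‖p.sStar k ω‖ := by
            refine ContinuousLinearMap.le_of_opNorm_le _ ?_ _
            rw [LinearIsometryEquiv.norm_map]
            exact hp.norm_R_le k ω
        _ ≤ c.κR * (2 * c.κR * c.η2 / c.θ / p.Λ k ω) := by gcongr
        _ ≤ c.step / p.Λ k ω := by
            rw [← mul_div_assoc]
            gcongr
            unfold Constants.step
            linarith

/-- With an accurate model and accurate estimates, the iteration is successful unless the gradient
of the objective is of order `1 / lam`. -/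
theorem IsMU2STREG.successful_of_threshold_le (hp : p.IsMU2STREG c x0 lam0)
    (hc : c.Valid Lφ κf κg) (hφ : IsSmoothBelow (p.φ k ω) Lφ) (hf : IsSmoothBelow f Lf)
    (hεf : εf ≤ κf) (hΛ : 0 < p.Λ k ω) (hI : ω ∈ p.I f κf κg k) (hJ : ω ∈ p.J f εf k)
    (hbig : c.threshold Lf Lφ κf κg / p.Λ k ω ≤ ‖∇ f (p.X k ω)‖) :
    p.Successful c k ω ∧ ‖∇ f (p.X k ω)‖ / 2 ≤ ‖p.G k ω‖ := by
  have hη1 := sub_pos.2 hc.η1_lt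
  have hκH := hc.κH_pos
  have hκg := hc.κg_nonneg
  have hη2 := hc.η2_pos
  have herr := hc.err_pos (Lf := Lf)
  have hfl : ‖∇ f (p.X k ω) - p.G k ω‖ ≤ κg / p.Λ k ω := by
    have := (Filter.Eventually.self_of_nhds hI).1
    rwa [Run.m, gradient_fineModel] at this
  have hzpart : 0 ≤ 16 * c.err Lf Lφ κf κg / ((1 - c.η1) * c.κH ^ 2) := by positivity
  have hκgΛ : κg / p.Λ k ω ≤ ‖∇ f (p.X k ω)‖ / 2 := by
    have : 2 * κg / p.Λ k ω ≤ ‖∇ f (p.X k ω)‖ := by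
      refine le_trans ?_ hbig
      unfold Constants.threshold
      gcongr
      linarith
    rw [mul_div_assoc] at this
    linarith
  have hG : ‖∇ f (p.X k ω)‖ / 2 ≤ ‖p.G k ω‖ := by
    have := norm_sub_norm_le (∇ f (p.X k ω)) (p.G k ω)
    linarith
  have hη2G : c.η2 / p.Λ k ω ≤ ‖p.G k ω‖ := by
    have : 2 * c.η2 / p.Λ k ω ≤ ‖∇ f (p.X k ω)‖ := by
      refine le_trans ?_ hbig
      unfold Constants.threshold
      gcongr
      linarith
    rw [mul_div_assoc] at this
    linarith
  have herrG : c.err Lf Lφ κf κg / p.Λ k ω ^ 2 ≤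
      (1 - c.η1) * (c.κH ^ 2 / 8 * (‖p.G k ω‖ / p.Λ k ω)) := by
    have h1 : 16 * c.err Lf Lφ κf κg / ((1 - c.η1) * c.κH ^ 2) / p.Λ k ω ≤ 2 * ‖p.G k ω‖ := by
      refine le_trans ?_ (hbig.trans (by linarith))
      unfold Constants.threshold
      gcongr
      linarith
    have h2 := mul_le_mul_of_nonneg_left h1
      (by positivity : 0 ≤ (1 - c.η1) * c.κH ^ 2 / 16 / p.Λ k ω)
    calc c.err Lf Lφ κf κg / p.Λ k ω ^ 2
        = (1 - c.η1) * c.κH ^ 2 / 16 / p.Λ k ω *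
          (16 * c.err Lf Lφ κf κg / ((1 - c.η1) * c.κH ^ 2) / p.Λ k ω) := by
            field_simp
      _ ≤ _ := h2
      _ = _ := by ring
  have h := hp.stepBounds hc hφ hΛ hη2G
  refine ⟨⟨?_, hη2G⟩, hG⟩
  have hG0 : 0 < ‖p.G k ω‖ := lt_of_lt_of_le (div_pos hη2 hΛ) hη2G
  have hpos : 0 < p.m0 k ω - p.ms k ω := lt_of_lt_of_le (by positivity) h.le_pred
  rw [Run.ρ, le_div_iff₀ hpos]
  have h1 := (abs_le.1 (hf.abs_sub_sub_inner_le (p.X k ω) (p.S k ω))).2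
  have h2 : ⟪∇ f (p.X k ω) - p.G k ω, p.S k ω⟫_ℝ ≤ κg * c.step / p.Λ k ω ^ 2 :=
    calc ⟪∇ f (p.X k ω) - p.G k ω, p.S k ω⟫_ℝ
        ≤ ‖∇ f (p.X k ω) - p.G k ω‖ * ‖p.S k ω‖ := real_inner_le_norm _ _
      _ ≤ κg / p.Λ k ω * (c.step / p.Λ k ω) := by gcongr; exact h.norm_le
      _ = _ := by ring
  rw [inner_sub_left] at h2
  have h3 : (Lf : ℝ) / 2 * ‖p.S k ω‖ ^ 2 ≤ Lf / 2 * c.step ^ 2 / p.Λ k ω ^ 2 :=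
    calc (Lf : ℝ) / 2 * ‖p.S k ω‖ ^ 2 ≤ Lf / 2 * (c.step / p.Λ k ω) ^ 2 := by gcongr; exact h.norm_le
      _ = _ := by rw [div_pow]; ring
  have h4 := (abs_le.1 hJ.1).1
  have h5 := (abs_le.1 hJ.2).2
  have h6 : εf / p.Λ k ω ^ 2 ≤ κf / p.Λ k ω ^ 2 := by gcongr
  have h7 : c.err Lf Lφ κf κg / p.Λ k ω ^ 2 = c.curv Lφ / p.Λ k ω ^ 2
      + κg * c.step / p.Λ k ω ^ 2 + Lf / 2 * c.step ^ 2 / p.Λ k ω ^ 2 + 2 * (κf / p.Λ k ω ^ 2) := by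
    unfold Constants.err
    ring
  have h8 := mul_le_mul_of_nonneg_left h.le_pred hη1.le
  have h9 := h.pred_le
  linarith

/-! ### The drift of the Lyapunov function -/

theorem IsMU2STREG.lyap_failure (hp : p.IsMU2STREG c x0 lam0) (hs : ¬ p.Successful c k ω) :
    p.lyap c f (k + 1) ω - p.lyap c f k ω = -(1 - c.γ ^ 2) * (1 / p.Λ k ω ^ 2) := by
  simp only [lyap, (hp.failure k ω hs).1, (hp.failure k ω hs).2, mul_pow, inv_pow, one_div, mul_inv,
    inv_inv]
  ring

theorem IsMU2STREG.lyap_success (hp : p.IsMU2STREG c x0 lam0) (hs : p.Successful c k ω) :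
    p.lyap c f (k + 1) ω - p.lyap c f k ω =
      c.weight * (f (p.X k ω + p.S k ω) - f (p.X k ω)) + (c.γ⁻¹ ^ 2 - 1) * (1 / p.Λ k ω ^ 2) := by
  simp only [lyap, (hp.success k ω hs).1, (hp.success k ω hs).2, mul_pow, inv_pow, one_div, mul_inv]
  ring

/-- With accurate estimates the Lyapunov function decreases by a multiple of `1 / lam ^ 2`, and in
a successful iteration by an additional multiple of `‖g‖ / lam`. -/
theorem IsMU2STREG.lyap_success_accurate (hp : p.IsMU2STREG c x0 lam0)
    (hc : c.Valid Lφ κf κg) (hφ : IsSmoothBelow (p.φ k ω) Lφ)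
    (hεf : εf ≤ c.η1 * c.η2 * c.κH ^ 2 / 32)
    (hΛ : 0 < p.Λ k ω) (hs : p.Successful c k ω) (hJ : ω ∈ p.J f εf k) :
    p.lyap c f (k + 1) ω - p.lyap c f k ω ≤
      -(1 / p.Λ k ω ^ 2) - 2 * c.gain * (‖p.G k ω‖ / p.Λ k ω) := by
  have hw := hc.weight_pos
  have hr := hc.rate_pos
  have hη2 := hc.η2_pos
  have h := (hp.stepBounds hc hφ hΛ hs.2).objective_decrease hc hεf hΛ hs hJ
  rw [hp.lyap_success hs]
  have h1 : c.weight * (f (p.X k ω + p.S k ω) - f (p.X k ω)) ≤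
      c.weight * (-(c.rate * (‖p.G k ω‖ / p.Λ k ω))) := by gcongr; linarith
  -- Half of the decrease of the objective is spent on the growth of `1 / lam ^ 2`.
  have h2 : c.γ⁻¹ ^ 2 * (1 / p.Λ k ω ^ 2) ≤ c.weight * c.rate / 2 * (‖p.G k ω‖ / p.Λ k ω) :=
    calc c.γ⁻¹ ^ 2 * (1 / p.Λ k ω ^ 2)
        = c.weight * c.rate / 2 * (c.η2 / p.Λ k ω / p.Λ k ω) := by
          unfold Constants.weight; field_simp
      _ ≤ _ := by gcongr; exact hs.2
  unfold Constants.gain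
  linarith

/-- The pointwise drift inequality: the Lyapunov function decreases, except for an increase of
controlled size in case the model or the estimates are inaccurate. -/
theorem IsMU2STREG.lyap_drift (hp : p.IsMU2STREG c x0 lam0)
    (hc : c.Valid Lφ κf κg) (hφ : IsSmoothBelow (p.φ k ω) Lφ) (hf : IsSmoothBelow f Lf)
    (hεf : εf ≤ min κf (c.η1 * c.η2 * c.κH ^ 2 / 32)) (hΛ : 0 < p.Λ k ω) :
    p.lyap c f (k + 1) ω - p.lyap c f k ω ≤
      -(1 - c.γ ^ 2) * (1 / p.Λ k ω ^ 2)
      - c.gain * p.bigGrad f (c.threshold Lf Lφ κf κg) k ω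
      + c.loss Lf Lφ κf κg *
        (p.bigGrad f (c.threshold Lf Lφ κf κg) k ω + 1 / p.Λ k ω ^ 2) *
        ((p.I f κf κg k)ᶜ.indicator 1 ω + (p.J f εf k)ᶜ.indicator 1 ω) := by
  obtain ⟨hεκ, hεη⟩ := le_min_iff.1 hεf
  have hγ := hc.γ_pos
  have hg := hc.gain_pos
  have hgl := hc.gain_lt_loss (Lf := Lf)
  have hw := hc.weight_pos
  have hstep := hc.step_pos
  have hζ := hc.threshold_pos (Lf := Lf)
  have hW := bigGrad_nonneg (f := f) hΛ (c.threshold Lf Lφ κf κg)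
  have hD := le_bigGrad_add (f := f) hΛ hζ.le
  set W := p.bigGrad f (c.threshold Lf Lφ κf κg) k ω with hWdef
  set u := 1 / p.Λ k ω ^ 2 with hu
  have hu0 : 0 < u := by positivity
  have hloss : 0 ≤ c.loss Lf Lφ κf κg * (W + u) := by
    have := hg.trans hgl
    positivity
  have hi : 0 ≤ (p.I f κf κg k)ᶜ.indicator (1 : Ω → ℝ) ω :=
    Set.indicator_nonneg (fun _ _ => zero_le_one) _
  by_cases hJ : ω ∈ p.J f εf k
  · have hj : (p.J f εf k)ᶜ.indicator (1 : Ω → ℝ) ω = 0 := by simp [hJ]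
    rw [hj, add_zero]
    have hbase : p.lyap c f (k + 1) ω - p.lyap c f k ω ≤ -(1 - c.γ ^ 2) * u := by
      by_cases hs : p.Successful c k ω
      · have := hp.lyap_success_accurate hc hφ hεη hΛ hs hJ
        have : 0 ≤ 2 * c.gain * (‖p.G k ω‖ / p.Λ k ω) := by positivity
        have : 0 ≤ c.γ ^ 2 * u := by positivity
        linarith
      · exact (hp.lyap_failure hs).le
    by_cases hI : ω ∈ p.I f κf κg k
    · have hi' : (p.I f κf κg k)ᶜ.indicator (1 : Ω → ℝ) ω = 0 := by simp [hI]
      rw [hi', mul_zero, add_zero]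
      by_cases hbig : c.threshold Lf Lφ κf κg / p.Λ k ω ≤ ‖∇ f (p.X k ω)‖
      · obtain ⟨hs, hG⟩ := hp.successful_of_threshold_le hc hφ hf hεκ hΛ hI hJ hbig
        have h1 := hp.lyap_success_accurate hc hφ hεη hΛ hs hJ
        have h2 : c.gain * W ≤ 2 * c.gain * (‖p.G k ω‖ / p.Λ k ω) :=
          calc c.gain * W = 2 * c.gain * (‖∇ f (p.X k ω)‖ / 2 / p.Λ k ω) := by
                rw [hWdef, bigGrad, if_pos hbig]; ring
            _ ≤ _ := by gcongr
        have : 0 ≤ c.γ ^ 2 * u := by positivity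
        linarith
      · have : W = 0 := by rw [hWdef, bigGrad, if_neg hbig]
        rw [this, mul_zero, sub_zero]
        exact hbase
    · have hi' : (p.I f κf κg k)ᶜ.indicator (1 : Ω → ℝ) ω = 1 := by simp [hI]
      rw [hi', mul_one]
      have : c.gain * W ≤ c.loss Lf Lφ κf κg * (W + u) :=
        mul_le_mul hgl.le (by linarith) hW (hg.trans hgl).le
      linarith
  · have hj : (p.J f εf k)ᶜ.indicator (1 : Ω → ℝ) ω = 1 := by simp [hJ]
    rw [hj]
    have hmain : p.lyap c f (k + 1) ω - p.lyap c f k ω ≤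
        -(1 - c.γ ^ 2) * u - c.gain * W + c.loss Lf Lφ κf κg * (W + u) := by
      have hγu : 0 ≤ c.γ ^ 2 * u := by positivity
      by_cases hs : p.Successful c k ω
      · have h1 := (hp.stepBounds hc hφ hΛ hs.2).objective_le hf
        rw [hp.lyap_success hs]
        have h2 : c.weight * (f (p.X k ω + p.S k ω) - f (p.X k ω)) ≤
            c.weight * (c.step * (W + c.threshold Lf Lφ κf κg * u) + Lf / 2 * c.step ^ 2 * u) := by
          have := mul_le_mul_of_nonneg_left hD hstep.le
          gcongr
          linarith
        have e1 : 0 ≤ c.weight * (c.step * c.threshold Lf Lφ κf κg * W) := by positivity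
        have e2 : 0 ≤ c.weight * (Lf / 2 * c.step ^ 2 * W) := by positivity
        have e3 : 0 ≤ c.weight * (c.step * u) := by positivity
        have e4 : 0 ≤ c.γ⁻¹ ^ 2 * W := by positivity
        have e5 : 0 ≤ c.gain * u := by positivity
        unfold Constants.loss
        linarith
      · rw [hp.lyap_failure hs]
        have : c.gain * W ≤ c.loss Lf Lφ κf κg * (W + u) :=
          mul_le_mul hgl.le (by linarith) hW (hg.trans hgl).le
        linarith
    have : c.loss Lf Lφ κf κg * (W + u) ≤ c.loss Lf Lφ κf κg * (W + u) *
        ((p.I f κf κg k)ᶜ.indicator 1 ω + 1) := le_mul_of_one_le_right hloss (by linarith)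
    linarith

end Run

end

/-! ### Measurability of the iterates -/

section Caratheodory

variable {Ω : Type*} [MeasurableSpace Ω] {n : ℕ} {u : Ω → E n → ℝ} {y v : Ω → E n} {L : ℝ≥0}

theorem measurable_eval_of_isSmoothBelow (hu : Measurable u) (hsm : ∀ ω, IsSmoothBelow (u ω) L)
    (hy : Measurable y) : Measurable fun ω => u ω (y ω) := by
  have h := measurable_uncurry_of_continuous_of_measurable (u := fun z ω => u ω z)
    (fun ω => (hsm ω).1.continuous) (fun z => (measurable_pi_apply z).comp hu)
  exact h.comp (hy.prodMk measurable_id)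

/-- Directional derivatives at a random point are limits of difference quotients. -/
theorem measurable_inner_gradient_of_isSmoothBelow (hu : Measurable u)
    (hsm : ∀ ω, IsSmoothBelow (u ω) L) (hy : Measurable y) (hv : Measurable v) :
    Measurable fun ω => ⟪∇ (u ω) (y ω), v ω⟫_ℝ := by
  refine measurable_of_tendsto_metrizable
    (f := fun (j : ℕ) ω => ((j : ℝ) + 1) • (u ω (y ω + (((j : ℝ) + 1)⁻¹) • v ω) - u ω (y ω)))
    (fun j => ?_) ?_
  · exact ((measurable_eval_of_isSmoothBelow hu hsm (hy.add (hv.const_smul (((j : ℝ) + 1)⁻¹)))).sub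
      (measurable_eval_of_isSmoothBelow hu hsm hy)).const_smul ((j : ℝ) + 1)
  · rw [tendsto_pi_nhds]
    intro ω
    have h := ((hsm ω).hasGradientAt (y ω)).hasFDerivAt.lim (v ω)
      (c := fun j : ℕ => (j : ℝ) + 1) (l := atTop) ?_
    · simpa using h
    · refine tendsto_norm_atTop_atTop.comp ?_
      exact tendsto_natCast_atTop_atTop.atTop_add tendsto_const_nhds

end Caratheodory

namespace Run

variable {Ω : Type*} {n nc : ℕ} {p : Run Ω n nc} {c : Constants} {Lf Lφ : ℝ≥0}
  {κf κg εf : ℝ} {x0 : E n} {lam0 : ℝ} {f : E n → ℝ} {k : ℕ} {ω : Ω}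

section Step

variable [MeasurableSpace Ω]

theorem measurable_S (hM : Measurable (p.M k)) (hΛ : Measurable (p.Λ k)) : Measurable (p.S k) := by
  have hG : Measurable (p.G k) := hM.fst
  have hR : Measurable (p.R k) := hM.snd.fst
  have hco : Measurable (p.coarse k) := hM.snd.snd.fst
  have hs : Measurable (p.sStar k) := hM.snd.snd.snd.snd
  unfold Run.S
  refine Measurable.ite (hco (MeasurableSet.of_discrete (s := {true}))) ?_ ?_
  · have hR' : Measurable fun ω => ContinuousLinearMap.adjoint (p.R k ω) :=
      (ContinuousLinearMap.adjoint (𝕜 := ℝ) (E := E n) (F := E nc)).continuous.measurable.comp hR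
    exact (isBoundedBilinearMap_apply (𝕜 := ℝ) (E := E nc) (F := E n)).continuous.measurable.comp
      (hR'.prodMk hs)
  · exact ((hΛ.mul hG.norm).inv.smul hG).neg

theorem measurableSet_successful (hM : Measurable (p.M k)) (hest : Measurable (p.est k))
    (hsm : ∀ ω, IsSmoothBelow (p.φ k ω) Lφ) (hX : Measurable (p.X k)) (hΛ : Measurable (p.Λ k)) :
    MeasurableSet {ω | p.Successful c k ω} := by
  have hG : Measurable (p.G k) := hM.fst
  have hR : Measurable (p.R k) := hM.snd.fst
  have hco : Measurable (p.coarse k) := hM.snd.snd.fst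
  have hφ : Measurable (p.φ k) := hM.snd.snd.snd.fst
  have hs : Measurable (p.sStar k) := hM.snd.snd.snd.snd
  have hF : Measurable (p.F k) := hest.fst
  have hFs : Measurable (p.Fs k) := hest.snd
  have hS := measurable_S hM hΛ
  have happ : Continuous fun q : (E n →L[ℝ] E nc) × E n => q.1 q.2 :=
    (isBoundedBilinearMap_apply (𝕜 := ℝ) (E := E n) (F := E nc)).continuous
  have hRX : Measurable fun ω => p.R k ω (p.X k ω) := happ.measurable.comp (hR.prodMk hX)
  have hRG : Measurable fun ω => p.R k ω (p.G k ω) := happ.measurable.comp (hR.prodMk hG)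
  have hφm : ∀ s : Ω → E nc, Measurable s → Measurable fun ω => p.phiModel k ω (s ω) := by
    intro s hs
    simp only [phiModel, coarseModel, inner_sub_left]
    exact (measurable_eval_of_isSmoothBelow hφ hsm (hRX.add hs)).add
      ((hRG.inner hs).sub (measurable_inner_gradient_of_isSmoothBelow hφ hsm hRX hs))
  have hm : ∀ y : Ω → E n, Measurable y → Measurable fun ω => p.m k ω (y ω) := by
    intro y hy
    exact hF.add (hG.inner (hy.sub hX))
  have hc := hco (MeasurableSet.of_discrete (s := {true}))
  have hm0 : Measurable (p.m0 k) := by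
    unfold Run.m0
    exact Measurable.ite hc (hφm (fun _ => 0) measurable_const) (hm _ hX)
  have hms : Measurable (p.ms k) := by
    unfold Run.ms
    exact Measurable.ite hc (hφm _ hs) (hm _ (hX.add hS))
  have hρ : Measurable (p.ρ k) := (hF.sub hFs).div (hm0.sub hms)
  exact (measurableSet_le measurable_const hρ).inter
    (measurableSet_le (measurable_const.div hΛ) hG.norm)

end Step

theorem measurable_M_past {j k : ℕ} (hjk : j < k) : Measurable[p.past k] (p.M j) := by
  have h : MeasurableSpace.comap (p.M j) inferInstance ⊔
      MeasurableSpace.comap (p.est j) inferInstance ≤ p.past k :=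
    le_iSup₂_of_le j (Finset.mem_range.2 hjk) le_rfl
  exact measurable_iff_comap_le.2 (le_sup_left.trans h)

theorem measurable_est_past {j k : ℕ} (hjk : j < k) : Measurable[p.past k] (p.est j) := by
  have h : MeasurableSpace.comap (p.M j) inferInstance ⊔
      MeasurableSpace.comap (p.est j) inferInstance ≤ p.past k :=
    le_iSup₂_of_le j (Finset.mem_range.2 hjk) le_rfl
  exact measurable_iff_comap_le.2 (le_sup_right.trans h)

theorem past_mono : Monotone p.past := by
  intro i j hij
  refine iSup₂_le fun l hl => ?_
  refine le_iSup₂_of_le l ?_ le_rfl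
  exact Finset.mem_range.2 ((Finset.mem_range.1 hl).trans_le hij)

variable [mΩ : MeasurableSpace Ω]

theorem IsMU2STREG.past_le (hp : p.IsMU2STREG c x0 lam0) (k : ℕ) : p.past k ≤ mΩ :=
  iSup₂_le fun j _ => sup_le (measurable_iff_comap_le.1 (hp.measurable_M j))
    (measurable_iff_comap_le.1 (hp.measurable_est j))

theorem IsMU2STREG.pastHalf_le (hp : p.IsMU2STREG c x0 lam0) (k : ℕ) : p.pastHalf k ≤ mΩ :=
  sup_le (hp.past_le k) (measurable_iff_comap_le.1 (hp.measurable_M k))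

/-- The iterate and the regularization parameter are determined by the past. -/
theorem IsMU2STREG.measurable_past (hp : p.IsMU2STREG c x0 lam0)
    (hφ : ∀ k ω, IsSmoothBelow (p.φ k ω) Lφ) (k : ℕ) :
    Measurable[p.past k] (p.X k) ∧ Measurable[p.past k] (p.Λ k) := by
  induction k with
  | zero =>
    rw [funext hp.X_zero, funext hp.Λ_zero]
    exact ⟨@measurable_const _ _ _ (p.past 0) _, @measurable_const _ _ _ (p.past 0) _⟩
  | succ k ih =>
    have hX := ih.1.mono (past_mono k.le_succ) le_rfl
    have hΛ := ih.2.mono (past_mono k.le_succ) le_rfl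
    have hM : Measurable[p.past (k + 1)] (p.M k) := measurable_M_past k.lt_succ_self
    have hest : Measurable[p.past (k + 1)] (p.est k) := measurable_est_past k.lt_succ_self
    have hS := @measurable_S _ _ _ p k (p.past (k + 1)) hM hΛ
    have hsucc := @measurableSet_successful _ _ _ p c Lφ k (p.past (k + 1)) hM hest (hφ k) hX hΛ
    classical
    have hXeq : p.X (k + 1) = fun ω => if p.Successful c k ω then p.X k ω + p.S k ω
        else p.X k ω := by
      funext ω
      split_ifs with hs
      exacts [(hp.success k ω hs).1, (hp.failure k ω hs).1]
    have hΛeq : p.Λ (k + 1) = fun ω => if p.Successful c k ω then c.γ * p.Λ k ω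
        else c.γ⁻¹ * p.Λ k ω := by
      funext ω
      split_ifs with hs
      exacts [(hp.success k ω hs).2, (hp.failure k ω hs).2]
    rw [hXeq, hΛeq]
    exact ⟨Measurable.ite hsucc (hX.add hS) hX,
      Measurable.ite hsucc (hΛ.const_mul _) (hΛ.const_mul _)⟩

/-! ### Boundedness at a fixed iteration -/

/-- At each iteration, the iterates and the inverse regularization parameters are bounded uniformly
over the sample space; hence all quantities below are integrable. -/
theorem IsMU2STREG.exists_bounds (hp : p.IsMU2STREG c x0 lam0) (hc : c.Valid Lφ κf κg)
    (hφ : ∀ k ω, IsSmoothBelow (p.φ k ω) Lφ) (hlam0 : 0 < lam0) (k : ℕ) :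
    ∃ r l : ℝ, 0 < l ∧ ∀ ω, ‖p.X k ω‖ ≤ r ∧ l ≤ p.Λ k ω := by
  have hγ := hc.γ_pos
  have hγ1 := hc.γ_lt
  have hst := hc.step_pos
  induction k with
  | zero => exact ⟨‖x0‖, lam0, hlam0, fun ω => by rw [hp.X_zero, hp.Λ_zero]; exact ⟨le_rfl, le_rfl⟩⟩
  | succ k ih =>
    obtain ⟨r, l, hl, h⟩ := ih
    refine ⟨r + c.step / l, c.γ * l, by positivity, fun ω => ?_⟩
    obtain ⟨hX, hΛ⟩ := h ω
    have hΛ0 := hl.trans_le hΛ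
    by_cases hs : p.Successful c k ω
    · rw [(hp.success k ω hs).1, (hp.success k ω hs).2]
      refine ⟨(norm_add_le _ _).trans (add_le_add hX ?_), by gcongr⟩
      exact (hp.stepBounds hc (hφ k ω) hΛ0 hs.2).norm_le.trans (by gcongr)
    · rw [(hp.failure k ω hs).1, (hp.failure k ω hs).2]
      refine ⟨hX.trans (le_add_of_nonneg_right (by positivity)), ?_⟩
      have : c.γ ≤ c.γ⁻¹ := hγ1.le.trans ((one_le_inv₀ hγ).2 hγ1.le)
      exact mul_le_mul this hΛ hl.le (by positivity)

theorem exists_bound_of_norm_le {g : E n → ℝ} (hg : Continuous g) (r : ℝ) :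
    ∃ C, ∀ x, ‖x‖ ≤ r → ‖g x‖ ≤ C := by
  obtain ⟨C, hC⟩ := (isCompact_closedBall (0 : E n) r).exists_bound_of_continuousOn hg.continuousOn
  exact ⟨C, fun x hx => hC x (by simpa using hx)⟩

theorem IsMU2STREG.exists_bound_inv_sq (hp : p.IsMU2STREG c x0 lam0) (hc : c.Valid Lφ κf κg)
    (hφ : ∀ k ω, IsSmoothBelow (p.φ k ω) Lφ) (hlam0 : 0 < lam0) (k : ℕ) :
    ∃ C, ∀ ω, ‖1 / p.Λ k ω ^ 2‖ ≤ C := by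
  obtain ⟨r, l, hl, h⟩ := hp.exists_bounds hc hφ hlam0 k
  refine ⟨1 / l ^ 2, fun ω => ?_⟩
  have := (h ω).2
  have := hl.trans_le this
  rw [Real.norm_of_nonneg (by positivity)]
  gcongr

theorem IsMU2STREG.exists_bound_bigGrad (hp : p.IsMU2STREG c x0 lam0) (hc : c.Valid Lφ κf κg)
    (hφ : ∀ k ω, IsSmoothBelow (p.φ k ω) Lφ) (hf : IsSmoothBelow f Lf) (hlam0 : 0 < lam0) (ζ : ℝ)
    (k : ℕ) : ∃ C, ∀ ω, ‖p.bigGrad f ζ k ω‖ ≤ C := by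
  obtain ⟨r, l, hl, h⟩ := hp.exists_bounds hc hφ hlam0 k
  obtain ⟨C, hC⟩ := exists_bound_of_norm_le hf.2.2.continuous.norm r
  refine ⟨C / l, fun ω => ?_⟩
  have h2 := (h ω).2
  have h1 : ‖∇ f (p.X k ω)‖ ≤ C := by simpa using hC _ (h ω).1
  have h3 := hl.trans_le h2
  have hC0 := (norm_nonneg _).trans h1
  rw [Real.norm_of_nonneg (bigGrad_nonneg h3 ζ)]
  unfold bigGrad
  split_ifs
  · gcongr
  · positivity

theorem IsMU2STREG.measurable_bigGrad (hp : p.IsMU2STREG c x0 lam0)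
    (hφ : ∀ k ω, IsSmoothBelow (p.φ k ω) Lφ) (hf : IsSmoothBelow f Lf) (ζ : ℝ) (k : ℕ) :
    Measurable[p.past k] (p.bigGrad f ζ k) := by
  obtain ⟨hX, hΛ⟩ := hp.measurable_past hφ k
  have hD : Measurable[p.past k] fun ω => ‖∇ f (p.X k ω)‖ :=
    hf.2.2.continuous.norm.measurable.comp hX
  unfold bigGrad
  exact Measurable.ite (measurableSet_le (hΛ.const_div _) hD) (hD.div hΛ) measurable_const

theorem IsMU2STREG.measurable_inv_sq (hp : p.IsMU2STREG c x0 lam0)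
    (hφ : ∀ k ω, IsSmoothBelow (p.φ k ω) Lφ) (k : ℕ) :
    Measurable[p.past k] fun ω => 1 / p.Λ k ω ^ 2 :=
  ((hp.measurable_past hφ k).2.pow_const 2).const_div 1

variable {μ : Measure Ω}

theorem IsMU2STREG.integrable_inv_sq [IsFiniteMeasure μ] (hp : p.IsMU2STREG c x0 lam0)
    (hc : c.Valid Lφ κf κg) (hφ : ∀ k ω, IsSmoothBelow (p.φ k ω) Lφ) (hlam0 : 0 < lam0) (k : ℕ) :
    Integrable (fun ω => 1 / p.Λ k ω ^ 2) μ := by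
  obtain ⟨C, hC⟩ := hp.exists_bound_inv_sq hc hφ hlam0 k
  exact .of_bound ((hp.measurable_inv_sq hφ k).mono (hp.past_le k) le_rfl).aestronglyMeasurable C
    (ae_of_all _ hC)

theorem IsMU2STREG.integrable_bigGrad [IsFiniteMeasure μ] (hp : p.IsMU2STREG c x0 lam0)
    (hc : c.Valid Lφ κf κg) (hφ : ∀ k ω, IsSmoothBelow (p.φ k ω) Lφ) (hf : IsSmoothBelow f Lf)
    (hlam0 : 0 < lam0) (ζ : ℝ) (k : ℕ) : Integrable (p.bigGrad f ζ k) μ := by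
  obtain ⟨C, hC⟩ := hp.exists_bound_bigGrad hc hφ hf hlam0 ζ k
  exact .of_bound ((hp.measurable_bigGrad hφ hf ζ k).mono (hp.past_le k) le_rfl).aestronglyMeasurable
    C (ae_of_all _ hC)

theorem IsMU2STREG.integrable_lyap [IsFiniteMeasure μ] (hp : p.IsMU2STREG c x0 lam0)
    (hc : c.Valid Lφ κf κg) (hφ : ∀ k ω, IsSmoothBelow (p.φ k ω) Lφ) (hf : IsSmoothBelow f Lf)
    (hlam0 : 0 < lam0) (k : ℕ) : Integrable (p.lyap c f k) μ := by
  obtain ⟨r, l, hl, h⟩ := hp.exists_bounds hc hφ hlam0 k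
  obtain ⟨C, hC⟩ := exists_bound_of_norm_le hf.1.continuous r
  have hX := (hp.measurable_past hφ k).1.mono (hp.past_le k) le_rfl
  have hfX : Integrable (fun ω => f (p.X k ω)) μ :=
    .of_bound (hf.1.continuous.measurable.comp hX).aestronglyMeasurable C
      (ae_of_all _ fun ω => hC _ (h ω).1)
  exact (hfX.const_mul _).add (hp.integrable_inv_sq hc hφ hlam0 k)

end Run

/-! ### Events of large conditional probability -/

/-- If `s` has conditional probability at least `α` given `m`, then the complement of `s` carries at
most the fraction `1 - α` of the integral of a nonnegative `m`-measurable function. Measurability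
of `s` is not needed: it holds up to null sets, since otherwise the conditional probability
would be zero by convention. -/
theorem integral_mul_indicator_compl_le {Ω : Type*} {m mΩ : MeasurableSpace Ω} {μ : Measure Ω}
    [IsProbabilityMeasure μ] (hm : m ≤ mΩ) {s : Set Ω} {α C : ℝ} (hα : 0 < α)
    (hs : ∀ᵐ ω ∂μ, α ≤ (μ⟦s | m⟧) ω) {g : Ω → ℝ} (hg : Measurable[m] g) (hg0 : ∀ ω, 0 ≤ g ω)
    (hgC : ∀ ω, ‖g ω‖ ≤ C) :
    Integrable (fun ω => g ω * sᶜ.indicator 1 ω) μ ∧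
      ∫ ω, g ω * sᶜ.indicator 1 ω ∂μ ≤ (1 - α) * ∫ ω, g ω ∂μ := by
  have hint : Integrable (s.indicator fun _ => (1 : ℝ)) μ := by
    by_contra hcon
    rw [condExp_of_not_integrable hcon] at hs
    obtain ⟨ω, hω⟩ := hs.exists
    exact absurd hω (not_le.2 hα)
  have hgm : AEStronglyMeasurable g μ := (hg.mono hm le_rfl).aestronglyMeasurable
  have hgi : Integrable g μ := .of_bound hgm C (ae_of_all _ hgC)
  have hprod : Integrable (fun ω => g ω * s.indicator (fun _ => (1 : ℝ)) ω) μ :=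
    hint.bdd_mul hgm (ae_of_all _ hgC)
  have hcompl : (fun ω => g ω * sᶜ.indicator 1 ω) =
      fun ω => g ω - g ω * s.indicator (fun _ => (1 : ℝ)) ω := by
    funext ω
    by_cases h : ω ∈ s <;> simp [h]
  have hpull : μ[fun ω => g ω * s.indicator (fun _ => (1 : ℝ)) ω | m] =ᵐ[μ]
      fun ω => g ω * (μ⟦s | m⟧) ω :=
    condExp_stronglyMeasurable_mul_of_bound hm hg.stronglyMeasurable hint C (ae_of_all _ hgC)
  have hge : α * ∫ ω, g ω ∂μ ≤ ∫ ω, g ω * s.indicator (fun _ => (1 : ℝ)) ω ∂μ := by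
    rw [← integral_condExp hm (f := fun ω => g ω * s.indicator (fun _ => (1 : ℝ)) ω),
      ← integral_const_mul]
    refine integral_mono_ae (hgi.const_mul _) integrable_condExp ?_
    filter_upwards [hs, hpull] with ω h1 h2
    rw [h2, mul_comm]
    exact mul_le_mul_of_nonneg_left h1 (hg0 ω)
  rw [hcompl]
  refine ⟨hgi.sub hprod, ?_⟩
  rw [integral_sub hgi hprod]
  linarith

/-! ### Summability -/

namespace Run

variable {Ω : Type*} [MeasurableSpace Ω] {μ : Measure Ω} [IsProbabilityMeasure μ] {n nc : ℕ}
  {p : Run Ω n nc} {c : Constants} {Lf Lφ : ℝ≥0} {κf κg εf : ℝ} {x0 : E n} {lam0 : ℝ} {f : E n → ℝ}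

/-- The expected decrease of the Lyapunov function, when the failure probability `δ` of the model
and of the estimates is small. -/
theorem IsMU2STREG.integral_lyap_succ_le (hp : p.IsMU2STREG c x0 lam0)
    (hc : c.Valid Lφ κf κg) (hφ : ∀ k ω, IsSmoothBelow (p.φ k ω) Lφ) (hf : IsSmoothBelow f Lf)
    (hεf : εf ≤ min κf (c.η1 * c.η2 * c.κH ^ 2 / 32)) (hlam0 : 0 < lam0) {δ : ℝ} (hδ : δ < 1)
    (hδgain : 2 * δ * c.loss Lf Lφ κf κg ≤ c.gain)
    (hδγ : 2 * δ * c.loss Lf Lφ κf κg ≤ (1 - c.γ ^ 2) / 2)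
    (hI : p.ProbFullyLinear μ f κf κg (1 - δ)) (hJ : p.ProbAccurate μ f εf (1 - δ)) (k : ℕ) :
    ∫ ω, p.lyap c f (k + 1) ω ∂μ + (1 - c.γ ^ 2) / 2 * ∫ ω, 1 / p.Λ k ω ^ 2 ∂μ ≤
      ∫ ω, p.lyap c f k ω ∂μ := by
  set ζ := c.threshold Lf Lφ κf κg
  set B := c.loss Lf Lφ κf κg
  have hB : 0 < B := hc.gain_pos.trans hc.gain_lt_loss
  have hΛ := hp.Λ_pos hc.γ_pos hlam0 k
  set W : Ω → ℝ := p.bigGrad f ζ k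
  set u : Ω → ℝ := fun ω => 1 / p.Λ k ω ^ 2
  have hW0 : ∀ ω, 0 ≤ W ω := fun ω => bigGrad_nonneg (hΛ ω) ζ
  have hu0 : ∀ ω, 0 ≤ u ω := fun ω => by have := hΛ ω; positivity
  have hWi : Integrable W μ := hp.integrable_bigGrad hc hφ hf hlam0 ζ k
  have hui : Integrable u μ := hp.integrable_inv_sq hc hφ hlam0 k
  obtain ⟨C1, hC1⟩ := hp.exists_bound_bigGrad hc hφ hf hlam0 ζ k
  obtain ⟨C2, hC2⟩ := hp.exists_bound_inv_sq hc hφ hlam0 k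
  have hgm : Measurable[p.past k] fun ω => W ω + u ω :=
    (hp.measurable_bigGrad hφ hf ζ k).add (hp.measurable_inv_sq hφ k)
  have hg0 : ∀ ω, 0 ≤ W ω + u ω := fun ω => add_nonneg (hW0 ω) (hu0 ω)
  have hgC : ∀ ω, ‖W ω + u ω‖ ≤ C1 + C2 := fun ω => norm_add_le_of_le (hC1 ω) (hC2 ω)
  obtain ⟨hIi, hIle⟩ := integral_mul_indicator_compl_le (hp.past_le k) (sub_pos.2 hδ) (hI k)
    hgm hg0 hgC
  obtain ⟨hJi, hJle⟩ := integral_mul_indicator_compl_le (hp.pastHalf_le k) (sub_pos.2 hδ) (hJ k)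
    (hgm.mono le_sup_left le_rfl) hg0 hgC
  have hL0 := hp.integrable_lyap (μ := μ) hc hφ hf hlam0 k
  have hL1 := hp.integrable_lyap (μ := μ) hc hφ hf hlam0 (k + 1)
  have hmono := integral_mono (hL1.sub hL0)
    (((hui.const_mul (-(1 - c.γ ^ 2))).sub (hWi.const_mul c.gain)).add ((hIi.add hJi).const_mul B))
    (fun ω => ?_)
  · rw [integral_sub' hL1 hL0, integral_add' ((hui.const_mul _).sub (hWi.const_mul _))
      ((hIi.add hJi).const_mul B), integral_sub' (hui.const_mul _) (hWi.const_mul _),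
      integral_const_mul, integral_const_mul, integral_const_mul, integral_add' hIi hJi] at hmono
    rw [integral_add hWi hui] at hIle hJle
    have hW : 0 ≤ ∫ ω, W ω ∂μ := integral_nonneg hW0
    have hu : 0 ≤ ∫ ω, u ω ∂μ := integral_nonneg hu0
    have h1 := mul_le_mul_of_nonneg_left (add_le_add hIle hJle) hB.le
    have h2 := mul_le_mul_of_nonneg_right hδgain hW
    have h3 := mul_le_mul_of_nonneg_right hδγ hu
    linarith
  · have := hp.lyap_drift (k := k) hc (hφ k ω) hf hεf (hΛ ω)
    simp only [Pi.sub_apply, Pi.add_apply]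
    refine this.trans (le_of_eq ?_)
    simp only [W, u, B, ζ]
    ring

theorem IsMU2STREG.ae_summable (hp : p.IsMU2STREG c x0 lam0)
    (hc : c.Valid Lφ κf κg) (hφ : ∀ k ω, IsSmoothBelow (p.φ k ω) Lφ) (hf : IsSmoothBelow f Lf)
    (hεf : εf ≤ min κf (c.η1 * c.η2 * c.κH ^ 2 / 32)) (hlam0 : 0 < lam0) {δ : ℝ} (hδ : δ < 1)
    (hδgain : 2 * δ * c.loss Lf Lφ κf κg ≤ c.gain)
    (hδγ : 2 * δ * c.loss Lf Lφ κf κg ≤ (1 - c.γ ^ 2) / 2)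
    (hI : p.ProbFullyLinear μ f κf κg (1 - δ)) (hJ : p.ProbAccurate μ f εf (1 - δ)) :
    ∀ᵐ ω ∂μ, Summable fun k : ℕ => 1 / p.Λ k ω ^ 2 := by
  have hσ : 0 < (1 - c.γ ^ 2) / 2 := by nlinarith [hc.γ_pos, hc.γ_lt]
  have hui := fun k => hp.integrable_inv_sq (μ := μ) hc hφ hlam0 k
  have hu0 : ∀ k ω, 0 ≤ 1 / p.Λ k ω ^ 2 := fun k ω => by
    have := hp.Λ_pos hc.γ_pos hlam0 k ω; positivity
  obtain ⟨b, hb⟩ := hf.2.1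
  have hlow : ∀ k, c.weight * b ≤ ∫ ω, p.lyap c f k ω ∂μ := by
    intro k
    have h := integral_mono (integrable_const (c.weight * b))
      (hp.integrable_lyap (μ := μ) hc hφ hf hlam0 k) (fun ω => ?_)
    · simpa using h
    · have h1 := mul_le_mul_of_nonneg_left (hb (Set.mem_range_self (p.X k ω))) hc.weight_pos.le
      have h2 := hu0 k ω
      simp only [lyap]
      linarith
  -- The expected decreases of the Lyapunov function telescope.
  have htel : ∀ N, (1 - c.γ ^ 2) / 2 * ∑ k ∈ Finset.range N, ∫ ω, 1 / p.Λ k ω ^ 2 ∂μ ≤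
      ∫ ω, p.lyap c f 0 ω ∂μ - ∫ ω, p.lyap c f N ω ∂μ := by
    intro N
    induction N with
    | zero => simp
    | succ N ih =>
      have := hp.integral_lyap_succ_le hc hφ hf hεf hlam0 hδ hδgain hδγ hI hJ N
      rw [Finset.sum_range_succ, mul_add]
      linarith
  have hsum : Summable fun k => ∫ ω, 1 / p.Λ k ω ^ 2 ∂μ := by
    refine summable_of_sum_range_le (c := (∫ ω, p.lyap c f 0 ω ∂μ - c.weight * b) /
      ((1 - c.γ ^ 2) / 2)) (fun k => integral_nonneg (hu0 k)) (fun N => ?_)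
    rw [le_div_iff₀' hσ]
    linarith [htel N, hlow N]
  have hlint : ∫⁻ ω, ∑' k, ENNReal.ofReal (1 / p.Λ k ω ^ 2) ∂μ ≠ ⊤ := by
    rw [lintegral_tsum fun k => (hui k).aestronglyMeasurable.aemeasurable.ennreal_ofReal]
    simp_rw [← fun k => ofReal_integral_eq_lintegral_ofReal (hui k) (ae_of_all _ (hu0 k))]
    exact hsum.tsum_ofReal_ne_top
  have hmeas : AEMeasurable (fun ω => ∑' k, ENNReal.ofReal (1 / p.Λ k ω ^ 2)) μ :=
    AEMeasurable.tsum fun k => (hui k).aestronglyMeasurable.aemeasurable.ennreal_ofReal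
  filter_upwards [ae_lt_top' hmeas hlint] with ω hω
  have := ENNReal.summable_toReal hω.ne
  simpa only [ENNReal.toReal_ofReal (hu0 _ ω)] using this

end Run

end MU2STREG

theorem mainTheorem1 (c : MU2STREG.Constants) (Lf Lφ : ℝ≥0) (κf κg : ℝ)
    (hη1 : 0 < c.η1) (hη1' : c.η1 < 1) (hγ : 0 < c.γ) (hγ' : c.γ < 1) (hθ : 0 < c.θ)
    (hκH : 0 < c.κH) (hκH' : c.κH < 1) (hκR : 0 < c.κR) (hκf : 0 < κf) (hκg : 0 ≤ κg)
    (hη2 : max (Lφ + c.θ) (24 * κf) ≤ c.η2) :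
    ∃ α ∈ Set.Ioo (0 : ℝ) 1, ∃ β ∈ Set.Ioo (0 : ℝ) 1,
      ∀ (εf : ℝ), 0 < εf → εf ≤ min κf (c.η1 * c.η2 * c.κH ^ 2 / 32) →
      ∀ (n nc : ℕ), nc ≤ n →
      ∀ (f : MU2STREG.E n → ℝ), MU2STREG.IsSmoothBelow f Lf →
      ∀ (Ω : Type*) [MeasurableSpace Ω] (μ : Measure Ω) [IsProbabilityMeasure μ]
        (x0 : MU2STREG.E n) (lam0 : ℝ), 0 < lam0 →
      ∀ (p : MU2STREG.Run Ω n nc), p.IsMU2STREG c x0 lam0 →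
        (∀ k ω, MU2STREG.IsSmoothBelow (p.φ k ω) Lφ) →
        p.ProbFullyLinear μ f κf κg α →
        p.ProbAccurate μ f εf β →
        ∀ᵐ ω ∂μ, Summable (fun k : ℕ => 1 / (p.Λ k ω) ^ 2) := by
  have hc : c.Valid Lφ κf κg :=
    ⟨hη1, hη1', hγ, hγ', hθ, hκH, hκH', hκR, hκf, hκg,
      (by positivity : 0 < 24 * κf).trans_le ((le_max_right _ _).trans hη2),
      (le_max_left _ _).trans hη2⟩
  have hgain := hc.gain_pos
  have hlt := hc.gain_lt_loss (Lf := Lf)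
  set B := c.loss Lf Lφ κf κg with hBdef
  have hB : 0 < B := hgain.trans hlt
  have hσ : 0 < (1 - c.γ ^ 2) / 2 := by nlinarith
  -- `2 * δ * B` has to be at most the gain and at most half of the drift `1 - γ ^ 2`; then `δ < 1`
  -- follows from `gain < B`.
  set δ := min c.gain ((1 - c.γ ^ 2) / 2) / (2 * B) with hδdef
  have hδ0 : 0 < δ := div_pos (lt_min hgain hσ) (by positivity)
  have hδB : 2 * δ * B = min c.gain ((1 - c.γ ^ 2) / 2) := by
    rw [hδdef]; field_simp
  have hδ1 : δ < 1 := by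
    rw [hδdef, div_lt_one (by positivity)]
    exact (min_le_left _ _).trans_lt (by linarith)
  refine ⟨1 - δ, ⟨by linarith, by linarith⟩, 1 - δ, ⟨by linarith, by linarith⟩, ?_⟩
  intro εf _ hεf n nc _ f hf Ω _ μ _ x0 lam0 hlam0 p hp hφ hI hJ
  exact hp.ae_summable hc hφ hf hεf hlam0 hδ1 (hδB.trans_le (min_le_left _ _))
    (hδB.trans_le (min_le_right _ _)) hI hJ
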